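/- All graphs are finite and simple. For a graph $G$ with at least one vertex, a weight assignment is a function $w:V(G)\to[0,\infty)$ that is not identically $0$; let $w(Y)=\sum_{y\in Y}w(y)$ for $Y\subseteq V(G)$, and let $\alpha_w(G)$ be the maximum of $w(Y)$ over all independent sets $Y$ of $G$. The fractional chromatic number $\chi_f(G)$ is the supremum of $w(V(G))/\alpha_w(G)$ over all weight assignments $w$. The Hall ratio $\rho(G)$ is the maximum of $|V(H)|/\alpha(H)$ over all non-empty subgraphs $H$ of $G$, where $\alpha(H)$ is the maximum size of an independent set of $H$. For every positive integer $c$, there exists a graph $G$ with $\chi_f(G)\ge c$ and $\rho(G)\le 18$. Moreover, the fractional chromatic number is not bounded by any function of the Hall ratio: there is no function $f:\mathbb{R}\to\mathbb{R}$ such that $\chi_f(G)\le f(\rho(G))$ for every non-empty graph $G$. -/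

import Mathlib

namespace SimpleGraph

/-- A weight assignment for a graph with vertex set `V`: a nonnegative real function on the
vertices that is not identically zero. -/
def IsWeightAssignment {V : Type*} (w : V → ℝ) : Prop :=
  (∀ v, 0 ≤ w v) ∧ ∃ v, w v ≠ 0

/-- `α_w(G)`: the maximum weight `∑ y ∈ Y, w y` of an independent set `Y` of a finite graph. -/
noncomputable def weightedIndepNum {V : Type*} (G : SimpleGraph V) (w : V → ℝ) : ℝ :=
  sSup {r : ℝ | ∃ Y : Finset V, G.IsIndepSet (Y : Set V) ∧ r = ∑ y ∈ Y, w y}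

/-- The fractional chromatic number: the supremum of `w(V(G)) / α_w(G)` over all weight
assignments `w`. -/
noncomputable def fractionalChromaticNumber {V : Type*} [Fintype V] (G : SimpleGraph V) : ℝ :=
  sSup {r : ℝ | ∃ w : V → ℝ, IsWeightAssignment w ∧ r = (∑ v, w v) / G.weightedIndepNum w}

/-- The Hall ratio: the maximum of `|V(H)| / α(H)` over all (nonempty, not necessarily induced)
subgraphs `H` of a finite graph. -/
noncomputable def hallRatio {V : Type*} (G : SimpleGraph V) : ℝ :=
  sSup {r : ℝ | ∃ H : G.Subgraph, H.verts.Nonempty ∧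
    r = (H.verts.ncard : ℝ) / (H.coe.indepNum : ℝ)}

/-- The supremum defining `α_w(G)` is a maximum. -/
theorem isGreatest_weightedIndepNum {V : Type*} [Finite V] (G : SimpleGraph V) (w : V → ℝ) :
    IsGreatest {r : ℝ | ∃ Y : Finset V, G.IsIndepSet (Y : Set V) ∧ r = ∑ y ∈ Y, w y}
      (G.weightedIndepNum w) := by
  have hfin : {r : ℝ | ∃ Y : Finset V, G.IsIndepSet (Y : Set V) ∧ r = ∑ y ∈ Y, w y}.Finite := by
    refine (Set.finite_range fun Y : Finset V => ∑ y ∈ Y, w y).subset ?_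
    rintro r ⟨Y, -, rfl⟩
    exact ⟨Y, rfl⟩
  exact ⟨Set.Nonempty.csSup_mem ⟨0, ∅, by simp, by simp⟩ hfin,
    fun r hr => le_csSup hfin.bddAbove hr⟩

theorem le_weightedIndepNum {V : Type*} [Finite V] (G : SimpleGraph V) (w : V → ℝ) (v : V) :
    w v ≤ G.weightedIndepNum w :=
  (G.isGreatest_weightedIndepNum w).2 ⟨{v}, by simp, by simp⟩

/-- The maximum weight of an independent set is positive, so the ratio is never a division
by zero. -/
theorem weightedIndepNum_pos {V : Type*} [Finite V] (G : SimpleGraph V) {w : V → ℝ}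
    (hw : IsWeightAssignment w) : 0 < G.weightedIndepNum w := by
  obtain ⟨h0, v, hv⟩ := hw
  exact lt_of_lt_of_le (lt_of_le_of_ne (h0 v) (Ne.symm hv)) (G.le_weightedIndepNum w v)

/-- The fractional chromatic number of a nonempty finite graph is a genuine supremum. -/
theorem isLUB_fractionalChromaticNumber {V : Type*} [Fintype V] [Nonempty V]
    (G : SimpleGraph V) :
    IsLUB {r : ℝ | ∃ w : V → ℝ, IsWeightAssignment w ∧
      r = (∑ v, w v) / G.weightedIndepNum w} G.fractionalChromaticNumber := by
  refine isLUB_csSup ⟨_, fun _ => 1, ⟨by simp, by simp⟩, rfl⟩ ⟨(Fintype.card V : ℝ), ?_⟩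
  rintro r ⟨w, hw, rfl⟩
  rw [div_le_iff₀ (G.weightedIndepNum_pos hw)]
  calc ∑ v, w v ≤ ∑ _v : V, G.weightedIndepNum w :=
        Finset.sum_le_sum fun v _ => G.le_weightedIndepNum w v
    _ = _ := by simp

/-- The Hall ratio of a nonempty finite graph is a genuine maximum. -/
theorem isGreatest_hallRatio {V : Type*} [Finite V] [Nonempty V] (G : SimpleGraph V) :
    IsGreatest {r : ℝ | ∃ H : G.Subgraph, H.verts.Nonempty ∧
      r = (H.verts.ncard : ℝ) / (H.coe.indepNum : ℝ)} G.hallRatio := by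
  have hfin : {r : ℝ | ∃ H : G.Subgraph, H.verts.Nonempty ∧
      r = (H.verts.ncard : ℝ) / (H.coe.indepNum : ℝ)}.Finite := by
    refine (Set.finite_range fun H : G.Subgraph =>
      (H.verts.ncard : ℝ) / (H.coe.indepNum : ℝ)).subset ?_
    rintro r ⟨H, -, rfl⟩
    exact ⟨H, rfl⟩
  exact ⟨Set.Nonempty.csSup_mem ⟨_, ⊤, by simp, rfl⟩ hfin,
    fun r hr => le_csSup hfin.bddAbove hr⟩

end SimpleGraph

/-! Take `k` layers of equal total weight `n`, with vertex weights growing, and layer sizes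
shrinking, very rapidly from one layer to the next. Draw `n` random pairs of vertices proportionally
to weight and keep as edges those between different layers.

With positive probability any two sets of weight at least `n / k` are hit by a pair
(`exists_sample_pairs`). An independent set then has more than `n / k` of weight in at most one
layer, hence weight at most `2 * n` out of `k * n`, and the fractional chromatic number is at least
`k / 2`.

For the Hall ratio, split a vertex set `A`. Vertices that are light relative to `#A` span so few
pairs that a quarter of them is independent (`exists_isIndepSet_of_sparse`). Of the rest, the lowest
layer is independent, and the higher layers are so small that they hold at most half of `A`. This
gives ratio at most 10 (`exists_layered_graph`).

A disjoint `K₁₈` makes the Hall ratio exactly 18. Since `f` need not be monotone, an upper bound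
alone would not refute it directly. -/

open Finset

/-! ### Counting and union bounds -/

/-- The number of functions that map a prescribed set of arguments into a prescribed set. -/
theorem card_filter_forall_mem {E Z : Type*} [Fintype E] [DecidableEq E] [Fintype Z]
    [DecidableEq Z] (F : Finset E) (T : Finset Z)
    [DecidablePred fun ω : E → Z => ∀ e ∈ F, ω e ∈ T] :
    #{ω : E → Z | ∀ e ∈ F, ω e ∈ T} =
      #T ^ #F * Fintype.card Z ^ (Fintype.card E - #F) := by
  have h : ({ω : E → Z | ∀ e ∈ F, ω e ∈ T} : Finset (E → Z)) =
      Fintype.piFinset fun e => if e ∈ F then T else univ := by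
    ext ω
    simp only [mem_filter, mem_univ, true_and, Fintype.mem_piFinset]
    refine forall_congr' fun e => ?_
    by_cases he : e ∈ F <;> simp [he]
  rw [h, Fintype.card_piFinset, ← Finset.prod_mul_prod_compl F]
  congr 1
  · rw [Finset.prod_congr rfl fun e he => by rw [if_pos he], Finset.prod_const]
  · rw [Finset.prod_congr rfl fun e he => by rw [if_neg (mem_compl.1 he)], Finset.prod_const,
      card_compl, card_univ]

/-- A union bound for the functions that map at least `r` arguments into a prescribed set. -/
theorem card_filter_le_card_mem_le {E Z : Type*} [Fintype E] [DecidableEq E] [Fintype Z]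
    [DecidableEq Z] (r : ℕ) (T : Finset Z) :
    #{ω : E → Z | r ≤ #{e | ω e ∈ T}} ≤
      (Fintype.card E).choose r * (#T ^ r * Fintype.card Z ^ (Fintype.card E - r)) := by
  have h : ({ω : E → Z | r ≤ #{e | ω e ∈ T}} : Finset (E → Z)) ⊆
      (powersetCard r univ).biUnion fun F => {ω : E → Z | ∀ e ∈ F, ω e ∈ T} := by
    intro ω hω
    obtain ⟨F, hF, hFr⟩ := exists_subset_card_eq (mem_filter.1 hω).2
    refine mem_biUnion.2 ⟨F, mem_powersetCard.2 ⟨subset_univ _, hFr⟩, ?_⟩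
    exact mem_filter.2 ⟨mem_univ _, fun e he => (mem_filter.1 (hF he)).2⟩
  refine (card_le_card h).trans (card_biUnion_le.trans ?_)
  rw [Finset.sum_congr rfl fun F hF => by
    rw [card_filter_forall_mem, (mem_powersetCard.1 hF).2], Finset.sum_const, card_powersetCard,
    card_univ, smul_eq_mul]

/-- Union bound over the sets of size `m` and weight `t` out of `M`: a random pair falls inside with
probability `(t / M) ^ 2`. The factorials cost at most `exp m * exp m ≤ 8 ^ m`, and the constant 32
turns this into `(8 / 32) ^ m`. -/
theorem choose_mul_choose_mul_pow_le {v n m t M : ℕ} (hv : v ≤ n) (hM : n ≤ M)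
    (ht : 32 * t ^ 4 ≤ m ^ 3 * n) :
    (v.choose m : ℝ) * (n.choose (2 * m) * ((t * t) ^ (2 * m) * (M * M) ^ (n - 2 * m))) ≤
      (1 / 4) ^ m * (M * M) ^ n := by
  rcases lt_or_ge n (2 * m) with hn | hn
  · rw [Nat.choose_eq_zero_of_lt hn]
    simp only [Nat.cast_zero, zero_mul, mul_zero]
    positivity
  have h1 : (v.choose m : ℝ) ≤ n ^ m / m.factorial :=
    (Nat.choose_le_pow_div m v).trans (by gcongr)
  have h2 : (n.choose (2 * m) : ℝ) ≤ n ^ (2 * m) / (2 * m).factorial :=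
    Nat.choose_le_pow_div (2 * m) n
  have h3 : ((t : ℝ) * t) ^ (2 * m) ≤ (m ^ 3 * n / 32) ^ m := by
    rw [pow_mul]
    gcongr
    have : (32 : ℝ) * t ^ 4 ≤ m ^ 3 * n := by exact_mod_cast ht
    linarith [show ((t : ℝ) * t) ^ 2 = t ^ 4 by ring]
  have h4 := Real.pow_div_factorial_le_exp (m : ℝ) (by positivity) m
  have h5 := Real.pow_div_factorial_le_exp (m : ℝ) (by positivity) (2 * m)
  have h6 : Real.exp m * Real.exp m ≤ 8 ^ m := by
    rw [← Real.exp_add, ← mul_two, Real.exp_nat_mul]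
    gcongr
    rw [show (2 : ℝ) = 1 + 1 by norm_num, Real.exp_add]
    nlinarith [Real.exp_one_lt_d9, Real.exp_pos 1]
  have h7 : (v.choose m : ℝ) * (n.choose (2 * m) * (t * t) ^ (2 * m)) ≤
      (1 / 4) ^ m * (M * M) ^ (2 * m) := by
    calc (v.choose m : ℝ) * (n.choose (2 * m) * (t * t) ^ (2 * m))
        ≤ n ^ m / m.factorial * (n ^ (2 * m) / (2 * m).factorial * (m ^ 3 * n / 32) ^ m) := by
          gcongr
      _ = (m ^ m / m.factorial * (m ^ (2 * m) / (2 * m).factorial)) * ((1 / 32) ^ m *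
            (n * n) ^ (2 * m)) := by
          rw [div_pow, mul_pow, mul_pow, div_pow, one_pow, ← pow_mul]
          field_simp
          ring
      _ ≤ 8 ^ m * ((1 / 32) ^ m * (M * M) ^ (2 * m)) := by
          gcongr
          exact (mul_le_mul h4 h5 (by positivity) (by positivity)).trans h6
      _ = _ := by rw [← mul_assoc, ← mul_pow]; norm_num
  calc (v.choose m : ℝ) * (n.choose (2 * m) * ((t * t) ^ (2 * m) * (M * M) ^ (n - 2 * m)))
      = (v.choose m : ℝ) * (n.choose (2 * m) * (t * t) ^ (2 * m)) * (M * M) ^ (n - 2 * m) := by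
        ring
    _ ≤ (1 / 4) ^ m * (M * M) ^ (2 * m) * (M * M) ^ (n - 2 * m) := by gcongr
    _ = _ := by rw [mul_assoc, ← pow_add, Nat.add_sub_cancel' hn]

/-- Grouping by size leaves the geometric series `1/4 + 1/16 + ⋯ = 1/3`. -/
theorem sum_pow_card_nonempty_le {V : Type*} [Fintype V] (g : ℕ → ℝ) {C : ℝ} (hC : 0 ≤ C)
    (hg : ∀ m, ((Fintype.card V).choose m : ℝ) * g m ≤ (1 / 4) ^ m * C) :
    ∑ S : Finset V with S.Nonempty, g #S ≤ 1 / 3 * C := by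
  classical
  have h : ∑ S : Finset V, (if S.Nonempty then g #S else 0) =
      ∑ m ∈ range (Fintype.card V + 1),
        (Fintype.card V).choose m • (if m = 0 then 0 else g m) := by
    rw [← Finset.powerset_univ, ← card_univ,
      ← Finset.sum_powerset_apply_card (fun m => if m = 0 then 0 else g m)]
    refine Finset.sum_congr rfl fun S _ => ?_
    by_cases hS : S = ∅ <;> simp [hS, nonempty_iff_ne_empty]
  rw [Finset.sum_filter, h, Finset.sum_range_succ']
  simp only [Nat.add_eq_zero_iff, one_ne_zero, and_false, if_false, if_true, smul_zero, add_zero,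
    nsmul_eq_mul]
  calc _ ≤ ∑ m ∈ range (Fintype.card V), (1 / 4 : ℝ) ^ (m + 1) * C :=
        Finset.sum_le_sum fun m _ => hg _
    _ = (∑ m ∈ range (Fintype.card V), (1 / 4 : ℝ) ^ m) * (1 / 4 * C) := by
        rw [Finset.sum_mul]
        exact Finset.sum_congr rfl fun m _ => by ring
    _ ≤ (4 / 3) * (1 / 4 * C) := by
        gcongr
        rw [geom_sum_eq (by norm_num)]
        have : (0 : ℝ) ≤ (1 / 4) ^ Fintype.card V := by positivity
        rw [div_le_iff_of_neg (by norm_num)]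
        linarith
    _ = _ := by ring

/-! ### The random sample -/

/-- Random pairs of vertices, drawn proportionally to `s`, hit all pairs of heavy sets, and few of
them lie inside a given small set of light vertices. -/
theorem exists_sample_pairs {V : Type*} [Fintype V] [DecidableEq V] (s : V → ℕ) {n k : ℕ}
    (hk : 0 < k) (hs : ∑ v, s v = k * n) (hV : k ^ 4 * (2 * Fintype.card V + 1) ≤ n) :
    ∃ p q : Fin n → V,
      (∀ Y Z : Finset V, n ≤ k * ∑ v ∈ Y, s v → n ≤ k * ∑ v ∈ Z, s v →
        ∃ e, p e ∈ Y ∧ q e ∈ Z) ∧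
      ∀ S : Finset V, S.Nonempty → (∀ v ∈ S, 32 * #S * s v ^ 4 ≤ n) →
        #{e | p e ∈ S ∧ q e ∈ S} < 2 * #S := by
  classical
  -- With `s v` copies of each vertex, uniform draws from `X` are draws proportional to `s`.
  let X := Σ v, Fin (s v)
  let T : Finset V → Finset X := fun S => S.sigma fun _ => univ
  have hT (S) : #(T S) = ∑ v ∈ S, s v := by simp [T, X]
  have hmem (S) (x : X) : x ∈ T S ↔ x.1 ∈ S := 
    mem_sigma.trans (and_iff_left (mem_univ _))
  have hX : Fintype.card X = k * n := by simp [X, hs]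
  have hk4 : 1 ≤ k ^ 4 := Nat.one_le_pow _ _ hk
  have hn : 2 * Fintype.card V + 1 ≤ n := by nlinarith
  let Bad₁ : Finset (Fin n → X × X) :=
    ({YZ : Finset V × Finset V | n ≤ k * #(T YZ.1) ∧ n ≤ k * #(T YZ.2)} : Finset _).biUnion
      fun YZ => {ω | ∀ e ∈ univ, ω e ∈ (T YZ.1 ×ˢ T YZ.2)ᶜ}
  let Bad₂ : Finset (Fin n → X × X) :=
    ({S : Finset V | S.Nonempty ∧ ∀ v ∈ S, 32 * #S * s v ^ 4 ≤ n} : Finset _).biUnion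
      fun S => {ω | 2 * #S ≤ #{e | ω e ∈ T S ×ˢ T S}}
  have hMpos : (0 : ℝ) < (k * n : ℕ) := by
    have : 0 < k * n := Nat.mul_pos hk (by omega)
    exact_mod_cast this
  have hΩ : (Fintype.card (Fin n → X × X) : ℝ) =
      ((k * n : ℕ) * (k * n : ℕ)) ^ n := by
    rw [Fintype.card_fun, Fintype.card_prod, hX, Fintype.card_fin]
    push_cast
    rfl
  have hb₁ : (#Bad₁ : ℝ) ≤ 1 / 2 * ((k * n : ℕ) * (k * n : ℕ)) ^ n := by
    -- Each of the two sets has at least `1 / k ^ 2` of the total weight `k * n`, so one draw misses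
    -- their product with probability at most `1 - 1 / k ^ 4`. Over `n` draws this outweighs the `4
    -- ^ |V|` choices of `YZ`.
    have hone (YZ : Finset V × Finset V) (h : n ≤ k * #(T YZ.1) ∧ n ≤ k * #(T YZ.2)) :
        (#{ω : Fin n → X × X | ∀ e ∈ univ, ω e ∈ (T YZ.1 ×ˢ T YZ.2)ᶜ} : ℝ) ≤
          Real.exp (-(2 * Fintype.card V + 1)) * ((k * n : ℕ) * (k * n : ℕ)) ^ n := by
      rw [card_filter_forall_mem, card_univ, Fintype.card_fin, Nat.sub_self, pow_zero, mul_one,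
        Nat.cast_pow, card_compl, Nat.cast_sub (card_le_univ _), Fintype.card_prod, card_product,
        hX]
      have hkpos : (0 : ℝ) < k := by exact_mod_cast hk
      have h1 : (n : ℝ) ≤ k * #(T YZ.1) := by exact_mod_cast h.1
      have h2 : (n : ℝ) ≤ k * #(T YZ.2) := by exact_mod_cast h.2
      have h3 : (n : ℝ) * n ≤ k * #(T YZ.1) * (k * #(T YZ.2)) :=
        mul_le_mul h1 h2 (by positivity) (by positivity)
      have h4 : (((k * n * (k * n) : ℕ) : ℝ) - (#(T YZ.1) * #(T YZ.2) : ℕ)) ≤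
          Real.exp (-(1 / k ^ 4)) * ((k * n : ℕ) * (k * n : ℕ)) := by
        have := Real.add_one_le_exp (-(1 / (k : ℝ) ^ 4))
        calc (((k * n * (k * n) : ℕ) : ℝ) - (#(T YZ.1) * #(T YZ.2) : ℕ))
            ≤ (-(1 / (k : ℝ) ^ 4) + 1) * ((k * n : ℕ) * (k * n : ℕ)) := by
              push_cast
              have : (n : ℝ) * n / k ^ 2 ≤ #(T YZ.1) * #(T YZ.2) := by
                rw [div_le_iff₀ (by positivity)]
                linarith
              have h5 : (-(1 / (k : ℝ) ^ 4) + 1) * (k * n * (k * n)) =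
                k * n * (k * n) - n * n / k ^ 2 := by
                field_simp
                ring
              linarith
          _ ≤ _ := by gcongr
      have h0 : (0 : ℝ) ≤ ((k * n * (k * n) : ℕ) : ℝ) - (#(T YZ.1) * #(T YZ.2) : ℕ) := by
        rw [sub_nonneg, Nat.cast_le, ← hX]
        exact Nat.mul_le_mul (card_le_univ _) (card_le_univ _)
      refine (pow_le_pow_left₀ h0 h4 n).trans ?_
      rw [mul_pow, ← Real.exp_nat_mul]
      gcongr
      have h6 : (k : ℝ) ^ 4 * (2 * Fintype.card V + 1) ≤ n := by exact_mod_cast hV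
      rw [mul_neg, neg_le_neg_iff, mul_one_div, le_div_iff₀ (by positivity)]
      linarith
    calc (#Bad₁ : ℝ) ≤ ∑ YZ : Finset V × Finset V with n ≤ k * #(T YZ.1) ∧ n ≤ k * #(T YZ.2),
          (#{ω : Fin n → X × X | ∀ e ∈ univ, ω e ∈ (T YZ.1 ×ˢ T YZ.2)ᶜ} : ℝ) := by
            exact_mod_cast card_biUnion_le
      _ ≤ ∑ YZ : Finset V × Finset V with n ≤ k * #(T YZ.1) ∧ n ≤ k * #(T YZ.2),
          Real.exp (-(2 * Fintype.card V + 1)) * ((k * n : ℕ) * (k * n : ℕ)) ^ n :=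
            Finset.sum_le_sum fun YZ h => hone YZ (mem_filter.1 h).2
      _ ≤ ∑ YZ : Finset V × Finset V,
          Real.exp (-(2 * Fintype.card V + 1)) * ((k * n : ℕ) * (k * n : ℕ)) ^ n :=
            Finset.sum_le_sum_of_subset_of_nonneg (filter_subset _ _) fun _ _ _ => by positivity
      _ = (2 * 2) ^ Fintype.card V * Real.exp (-(2 * Fintype.card V + 1)) *
            ((k * n : ℕ) * (k * n : ℕ)) ^ n := by
            simp only [Finset.sum_const, card_univ, Fintype.card_prod, Fintype.card_finset,
              nsmul_eq_mul, Nat.cast_mul, Nat.cast_pow, Nat.cast_ofNat, mul_pow]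
            ring
      _ ≤ 1 / 2 * ((k * n : ℕ) * (k * n : ℕ)) ^ n := by
            gcongr
            have h2 : (2 : ℝ) ≤ Real.exp 1 := by linarith [Real.add_one_le_exp (1 : ℝ)]
            have h3 : (2 * 2 : ℝ) ^ Fintype.card V ≤ Real.exp (2 * Fintype.card V) := by
              rw [mul_comm (2 : ℝ) (Fintype.card V : ℝ), Real.exp_nat_mul]
              gcongr
              rw [← one_add_one_eq_two, Real.exp_add, one_add_one_eq_two]
              gcongr
            calc _ ≤ Real.exp (2 * Fintype.card V) * Real.exp (-(2 * Fintype.card V + 1)) := by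
                  gcongr
              _ = (Real.exp 1)⁻¹ := by rw [← Real.exp_add, ← Real.exp_neg]; congr 1; ring
              _ ≤ 1 / 2 := by rw [one_div]; gcongr
  have hb₂ : (#Bad₂ : ℝ) ≤ 1 / 3 * ((k * n : ℕ) * (k * n : ℕ)) ^ n := by
    have hlight (S : Finset V) (hS : S.Nonempty) (h : ∀ v ∈ S, 32 * #S * s v ^ 4 ≤ n) :
        32 * #(T S) ^ 4 ≤ #S ^ 3 * n := by
      obtain ⟨v, hv, hmax⟩ := exists_max_image S s hS
      have h1 : #(T S) ≤ #S * s v := by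
        rw [hT, ← smul_eq_mul]
        exact sum_le_card_nsmul _ _ _ hmax
      calc 32 * #(T S) ^ 4 ≤ 32 * (#S * s v) ^ 4 := by gcongr
        _ = #S ^ 3 * (32 * #S * s v ^ 4) := by ring
        _ ≤ _ := by gcongr; exact h v hv
    -- The bound for size `m` is shared equally among the sets of that size. For `m > |V|` the
    -- division by zero gives 0.
    let g : ℕ → ℝ := fun m =>
      (1 / 4) ^ m * ((k * n : ℕ) * (k * n : ℕ)) ^ n / (Fintype.card V).choose m
    calc (#Bad₂ : ℝ) ≤ ∑ S : Finset V with S.Nonempty ∧ ∀ v ∈ S, 32 * #S * s v ^ 4 ≤ n,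
          (#{ω : Fin n → X × X | 2 * #S ≤ #{e | ω e ∈ T S ×ˢ T S}} : ℝ) := by
            exact_mod_cast card_biUnion_le
      _ ≤ ∑ S : Finset V with S.Nonempty ∧ ∀ v ∈ S, 32 * #S * s v ^ 4 ≤ n, g #S := by
            refine Finset.sum_le_sum fun S hS => ?_
            obtain ⟨-, hS, h⟩ := mem_filter.1 hS
            have h1 := card_filter_le_card_mem_le (E := Fin n) (2 * #S) (T S ×ˢ T S)
            rw [card_product, Fintype.card_prod, hX, Fintype.card_fin] at h1
            have h2 : (0 : ℝ) < (Fintype.card V).choose #S := by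
              exact_mod_cast Nat.choose_pos (card_le_univ S)
            rw [le_div_iff₀ h2, mul_comm]
            refine le_trans ?_ (choose_mul_choose_mul_pow_le (v := Fintype.card V) (by omega)
              (Nat.le_mul_of_pos_left n hk) (hlight S hS h))
            exact mul_le_mul_of_nonneg_left (by exact_mod_cast h1) (Nat.cast_nonneg _)
      _ ≤ ∑ S : Finset V with S.Nonempty, g #S :=
            Finset.sum_le_sum_of_subset_of_nonneg
              (monotone_filter_right _ fun S _ hS => hS.1) fun _ _ _ => by positivity
      _ ≤ _ := by
            refine sum_pow_card_nonempty_le g (by positivity) fun m => ?_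
            rcases eq_or_ne ((Fintype.card V).choose m : ℝ) 0 with h | h
            · rw [h, zero_mul]
              positivity
            · exact (mul_div_cancel₀ _ h).le
  -- The bad events have total probability at most `1/2 + 1/3 < 1`.
  obtain ⟨ω, hω⟩ : ∃ ω, ω ∉ Bad₁ ∪ Bad₂ := by
    by_contra! h
    have h1 : (Fintype.card (Fin n → X × X) : ℝ) ≤ #Bad₁ + #Bad₂ := by
      rw [← card_univ, ← eq_univ_of_forall h]
      exact_mod_cast card_union_le _ _
    rw [hΩ] at h1
    have : 0 < (((k * n : ℕ) : ℝ) * (k * n : ℕ)) ^ n := by positivity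
    linarith
  rw [mem_union, not_or] at hω
  refine ⟨fun e => (ω e).1.1, fun e => (ω e).2.1, fun Y Z hY hZ => ?_, fun S hS h => ?_⟩
  · by_contra! hYZ
    refine hω.1 (mem_biUnion.2 ⟨(Y, Z), ?_, ?_⟩)
    · simpa only [mem_filter, mem_univ, true_and, hT] using ⟨hY, hZ⟩
    · simp only [mem_filter, mem_univ, true_and, mem_compl, mem_product, hmem, not_and]
      exact fun e _ => hYZ e
  · by_contra! hc
    refine hω.2 (mem_biUnion.2 ⟨S, mem_filter.2 ⟨mem_univ _, hS, h⟩, ?_⟩)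
    simpa only [mem_filter, mem_univ, true_and, mem_product, hmem] using hc

/-! ### Bounds for the two graph parameters -/

namespace SimpleGraph

/-- A subgraph has no more edges than `G`, so a set independent in `G` stays independent in it, and
only its vertex set matters. -/
theorem hallRatio_le {V : Type*} [Finite V] [Nonempty V] (G : SimpleGraph V) {r : ℝ}
    (h : ∀ A : Finset V, A.Nonempty → ∃ T ⊆ A, G.IsIndepSet (T : Set V) ∧ (#A : ℝ) ≤ r * #T) :
    G.hallRatio ≤ r := by
  classical
  obtain ⟨H, hH, hr⟩ := G.isGreatest_hallRatio.1
  rw [hr]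
  have hfin : H.verts.Finite := Set.toFinite _
  obtain ⟨T, hTA, hT, hle⟩ := h hfin.toFinset (by simpa using hH)
  rw [← Set.ncard_eq_toFinset_card _ hfin] at hle
  have hpos : (0 : ℝ) < H.verts.ncard := by
    exact_mod_cast (Set.ncard_pos hfin).2 hH
  have hr0 : 0 ≤ r := by
    by_contra! hneg
    have : r * (#T : ℝ) ≤ 0 := mul_nonpos_of_nonpos_of_nonneg hneg.le (Nat.cast_nonneg _)
    linarith
  have hsub : ∀ v ∈ T, v ∈ H.verts := fun v hv => by simpa using hTA hv
  have hindep : H.coe.IsIndepSet (T.subtype (· ∈ H.verts) : Set H.verts) := by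
    intro u hu v hv huv hadj
    rw [mem_coe, mem_subtype] at hu hv
    exact hT hu hv (fun h => huv (Subtype.ext h)) (H.adj_sub hadj)
  have hcard : #T ≤ H.coe.indepNum := by
    have := hindep.card_le_indepNum
    rwa [card_subtype, filter_true_of_mem hsub] at this
  have hTpos : (0 : ℝ) < #T := by
    by_contra! hT0
    have : (#T : ℝ) = 0 := le_antisymm hT0 (Nat.cast_nonneg _)
    rw [this, mul_zero] at hle
    linarith
  have hcard' : (#T : ℝ) ≤ H.coe.indepNum := by exact_mod_cast hcard
  rw [div_le_iff₀ (hTpos.trans_le hcard')]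
  exact hle.trans (by gcongr)

theorem IsClique.card_le_hallRatio {V : Type*} [Finite V] [Nonempty V] {G : SimpleGraph V}
    {K : Finset V} (hK : G.IsClique (K : Set V)) (hne : K.Nonempty) : (#K : ℝ) ≤ G.hallRatio := by
  let H : G.Subgraph := (⊤ : G.Subgraph).induce (K : Set V)
  have hle : H.coe.indepNum ≤ 1 := by
    obtain ⟨T, hT⟩ := H.coe.exists_isNIndepSet_indepNum
    rw [← hT.card_eq, card_le_one]
    intro u hu v hv
    by_contra huv
    refine hT.isIndepSet hu hv huv ?_
    have hu' : (u : V) ∈ K := u.2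
    have hv' : (v : V) ∈ K := v.2
    simpa [H, hu', hv'] using hK hu' hv' fun h => huv (Subtype.ext h)
  have hge : 1 ≤ H.coe.indepNum := by
    obtain ⟨v, hv⟩ := hne
    have : H.coe.IsIndepSet (({⟨v, hv⟩} : Finset H.verts) : Set H.verts) := by simp
    simpa using this.card_le_indepNum
  refine G.isGreatest_hallRatio.2 ⟨H, by simpa [H] using hne, ?_⟩
  rw [le_antisymm hle hge]
  simp [H]

theorem le_fractionalChromaticNumber {V : Type*} [Fintype V] [Nonempty V] (G : SimpleGraph V)
    {w : V → ℝ} (hw : IsWeightAssignment w) {b c : ℝ} (hc : 0 ≤ c)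
    (hb : ∀ Y : Finset V, G.IsIndepSet (Y : Set V) → ∑ y ∈ Y, w y ≤ b)
    (h : c * b ≤ ∑ v, w v) : c ≤ G.fractionalChromaticNumber := by
  refine le_trans ?_ (G.isLUB_fractionalChromaticNumber.1 ⟨w, hw, rfl⟩)
  rw [le_div_iff₀ (G.weightedIndepNum_pos hw)]
  obtain ⟨Y, hY, hYw⟩ := (G.isGreatest_weightedIndepNum w).1
  refine le_trans ?_ h
  rw [hYw]
  exact mul_le_mul_of_nonneg_left (hb Y hY) hc

/-! ### Sparse sets and the layered graph -/

/-- If all nonempty subsets of `B` contain few of the sampled pairs, then `B` contains a large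
independent set. -/
theorem exists_isIndepSet_of_sparse {V E : Type*} [DecidableEq V] [Fintype E]
    (G : SimpleGraph V) (p q : E → V)
    (hG : ∀ u v, G.Adj u v → ∃ e, (p e = u ∧ q e = v) ∨ (p e = v ∧ q e = u)) (B : Finset V)
    (hB : ∀ S ⊆ B, S.Nonempty → #{e | p e ∈ S ∧ q e ∈ S} < 2 * #S) :
    ∃ T ⊆ B, G.IsIndepSet (T : Set V) ∧ #B ≤ 4 * #T := by
  classical
  induction B using Finset.strongInduction with
  | H B ih =>
  rcases B.eq_empty_or_nonempty with rfl | hne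
  · exact ⟨∅, Subset.rfl, by simp, by simp⟩
  obtain ⟨v, hv, hdeg⟩ : ∃ v ∈ B, #{u ∈ B | G.Adj v u} ≤ 3 := by
    -- If all degrees within `B` were at least 4, counting endpoints would give `2 * #I ≥ 4 * #B`.
    by_contra! hdeg
    let I : Finset E := {e | p e ∈ B ∧ q e ∈ B}
    have hp : #I = ∑ v ∈ B, #{e ∈ I | p e = v} :=
      card_eq_sum_card_fiberwise fun e he => (mem_filter.1 he).2.1
    have hq : #I = ∑ v ∈ B, #{e ∈ I | q e = v} :=
      card_eq_sum_card_fiberwise fun e he => (mem_filter.1 he).2.2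
    have h1 (v) (hv : v ∈ B) : 4 ≤ #{e ∈ I | p e = v} + #{e ∈ I | q e = v} := by
      refine (Nat.succ_le_of_lt (hdeg v hv)).trans ?_
      have hsub : ({u ∈ B | G.Adj v u} : Finset V) ⊆
          ({e ∈ I | p e = v} : Finset E).image q ∪ ({e ∈ I | q e = v} : Finset E).image p := by
        intro u hu
        obtain ⟨huB, huv⟩ := mem_filter.1 hu
        obtain ⟨e, ⟨rfl, rfl⟩ | ⟨rfl, rfl⟩⟩ := hG v u huv
        · exact mem_union_left _ (mem_image.2 ⟨e, by simp [I, huB, hv], rfl⟩)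
        · exact mem_union_right _ (mem_image.2 ⟨e, by simp [I, huB, hv], rfl⟩)
      exact (card_le_card hsub).trans ((card_union_le _ _).trans
        (add_le_add card_image_le card_image_le))
    have h2 := card_nsmul_le_sum B _ 4 h1
    rw [Finset.sum_add_distrib, ← hp, ← hq, smul_eq_mul] at h2
    have h3 : #I < 2 * #B := hB B Subset.rfl hne
    omega
  let B' : Finset V := {u ∈ B | u ≠ v ∧ ¬ G.Adj v u}
  have hB' : B' ⊆ B := filter_subset _ _
  have hvB' : v ∉ B' := by simp [B']
  obtain ⟨T, hT, hTi, hTc⟩ := ih B' (hB'.ssubset_of_mem_notMem hv hvB')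
    fun S hS => hB S (hS.trans hB')
  have hcard : #B ≤ #B' + 4 := by
    have : B ⊆ B' ∪ insert v ({u ∈ B | G.Adj v u} : Finset V) := by
      intro u hu
      by_cases h1 : u = v <;> by_cases h2 : G.Adj v u <;> simp [B', h1, h2, hu]
    have h1 := (card_le_card this).trans (card_union_le _ _)
    have h2 := card_insert_le v ({u ∈ B | G.Adj v u} : Finset V)
    omega
  refine ⟨insert v T, insert_subset hv (hT.trans hB'), ?_, ?_⟩
  · rw [coe_insert]
    refine Set.Pairwise.insert hTi fun u hu huv => ?_
    have := (mem_filter.1 (hT hu)).2.2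
    exact ⟨this, fun h => this h.symm⟩
  · rw [card_insert_of_notMem fun h => hvB' (hT h)]
    omega

theorem exists_layered_graph {k : ℕ} (hk : 0 < k) :
    ∃ (V : Type) (_ : Fintype V) (G : SimpleGraph V) (w : V → ℝ), IsWeightAssignment w ∧
      (∀ Y : Finset V, G.IsIndepSet (Y : Set V) → k * ∑ y ∈ Y, w y ≤ 2 * ∑ v, w v) ∧
      ∀ A : Finset V, A.Nonempty → ∃ T ⊆ A, G.IsIndepSet (T : Set V) ∧ #A ≤ 10 * #T := by
  classical
  -- The factor `k ^ 5` makes `n` large enough for the sampling lemma; `64 * k = 32 * (2 * k)` makes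
  -- each higher layer smaller than `#A / (2 * k)` below.
  obtain ⟨a, ha⟩ : ∃ a, a = 64 * k ^ 5 := ⟨_, rfl⟩
  have hk4 : 1 ≤ k ^ 4 := Nat.one_le_pow _ _ hk
  have hk5 : k ^ 5 = k ^ 4 * k := pow_succ k 4
  have hak : 64 * k ≤ a := by rw [ha, hk5]; nlinarith
  have ha0 : 0 < a := by omega
  let s : Fin k → ℕ := fun i => a ^ 5 ^ (i : ℕ)
  let m : Fin k → ℕ := fun i => a ^ (5 ^ k - 5 ^ (i : ℕ))
  obtain ⟨n, hn⟩ : ∃ n, n = a ^ 5 ^ k := ⟨_, rfl⟩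
  have hms (i) : m i * s i = n := by
    rw [hn, ← pow_add, Nat.sub_add_cancel (Nat.pow_le_pow_right (by norm_num) i.2.le)]
  have hsa (i) : a ≤ s i := Nat.le_self_pow (pow_ne_zero _ (by norm_num)) a
  -- Exponents grow by a factor 5: four for the fourth power in the lightness condition, the fifth
  -- for the extra `a`.
  have hsep {i j : Fin k} (hij : i < j) : a * s i ^ 4 ≤ s j := by
    have h1 : 5 ^ ((i : ℕ) + 1) ≤ 5 ^ (j : ℕ) := Nat.pow_le_pow_right (by norm_num) hij
    have h2 : 1 + 5 ^ (i : ℕ) * 4 ≤ 5 ^ (j : ℕ) := by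
      have := Nat.one_le_pow (i : ℕ) 5 (by norm_num)
      rw [pow_succ] at h1
      omega
    calc a * s i ^ 4 = a ^ (1 + 5 ^ (i : ℕ) * 4) := by rw [pow_add, pow_one, pow_mul]
      _ ≤ s j := Nat.pow_le_pow_right ha0 h2
  let V := Σ i, Fin (m i)
  have hcardV : Fintype.card V = ∑ i, m i := by simp [V]
  have hsum : ∑ v : V, s v.1 = k * n := by
    rw [Fintype.sum_sigma]
    simp [hms]
  have hVk : a * Fintype.card V ≤ k * n := by
    rw [hcardV, mul_sum]
    calc _ ≤ ∑ i : Fin k, n := Finset.sum_le_sum fun i _ => by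
          rw [← hms i, mul_comm]
          exact Nat.mul_le_mul_left _ (hsa i)
      _ = _ := by simp
  have hV1 : 1 ≤ Fintype.card V := by
    rw [hcardV]
    exact (Nat.one_le_pow _ _ ha0).trans
      (single_le_sum (f := m) (fun _ _ => Nat.zero_le _) (mem_univ ⟨0, hk⟩))
  have hVn : k ^ 4 * (2 * Fintype.card V + 1) ≤ n := by
    refine Nat.le_of_mul_le_mul_left ?_ ha0
    calc a * (k ^ 4 * (2 * Fintype.card V + 1)) ≤ a * (k ^ 4 * (3 * Fintype.card V)) := by
          gcongr
          omega
      _ = 3 * k ^ 4 * (a * Fintype.card V) := by ring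
      _ ≤ 3 * k ^ 4 * (k * n) := by gcongr
      _ = 3 * k ^ 5 * n := by ring
      _ ≤ a * n := by
          rw [ha]
          gcongr
          norm_num
  obtain ⟨p, q, hheavy, hsparse⟩ := exists_sample_pairs (fun v : V => s v.1) hk hsum hVn
  let G : SimpleGraph V := fromRel fun u v => u.1 ≠ v.1 ∧ ∃ e, p e = u ∧ q e = v
  have hGlayer {u v : V} (h : G.Adj u v) : u.1 ≠ v.1 :=
    ((fromRel_adj _ _ _).1 h).2.elim (fun h => h.1) fun h => h.1.symm
  have hGsample (u v : V) (h : G.Adj u v) : ∃ e, (p e = u ∧ q e = v) ∨ (p e = v ∧ q e = u) :=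
    ((fromRel_adj _ _ _).1 h).2.elim (fun ⟨_, e, he⟩ => ⟨e, .inl he⟩)
      fun ⟨_, e, he⟩ => ⟨e, .inr he⟩
  have hGadj (e) (h : (p e).1 ≠ (q e).1) : G.Adj (p e) (q e) :=
    (fromRel_adj _ _ _).2 ⟨fun h' => h (congrArg _ h'), .inl ⟨h, e, rfl, rfl⟩⟩
  have hfiber (S : Finset V) (i : Fin k) : #{v ∈ S | v.1 = i} ≤ m i := by
    calc #{v ∈ S | v.1 = i} ≤ #((univ : Finset (Fin (m i))).image fun x => (⟨i, x⟩ : V)) := by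
          refine card_le_card fun v hv => ?_
          obtain ⟨-, rfl⟩ := mem_filter.1 hv
          exact mem_image.2 ⟨v.2, mem_univ _, rfl⟩
      _ ≤ m i := card_image_le.trans (by simp)
  refine ⟨V, inferInstance, G, fun v => s v.1, ⟨fun v => by positivity, ?_⟩, fun Y hY => ?_,
    fun A hA => ?_⟩
  · obtain ⟨v⟩ := Fintype.card_pos_iff.1 hV1
    exact ⟨v, Nat.cast_ne_zero.2 (ha0.trans_le (hsa _)).ne'⟩
  · have hlayer (i : Fin k) : ∑ v ∈ Y with v.1 = i, s v.1 ≤ n := by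
      rw [Finset.sum_congr rfl fun v hv => by rw [(mem_filter.1 hv).2], Finset.sum_const,
        smul_eq_mul, ← hms i]
      exact Nat.mul_le_mul_right _ (hfiber Y i)
    have htwo {i j : Fin k} (hij : i ≠ j) (hi : n ≤ k * ∑ v ∈ Y with v.1 = i, s v.1) :
        k * ∑ v ∈ Y with v.1 = j, s v.1 < n := by
      by_contra! hj
      obtain ⟨e, hp, hq⟩ := hheavy _ _ hi hj
      obtain ⟨hpY, hpi⟩ := mem_filter.1 hp
      obtain ⟨hqY, hqj⟩ := mem_filter.1 hq
      have hne : (p e).1 ≠ (q e).1 := by rwa [hpi, hqj]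
      exact hY hpY hqY (hGadj e hne).ne (hGadj e hne)
    obtain ⟨i, hi⟩ : ∃ i : Fin k, ∀ j ≠ i, k * ∑ v ∈ Y with v.1 = j, s v.1 ≤ n := by
      by_cases h : ∃ i : Fin k, n ≤ k * ∑ v ∈ Y with v.1 = i, s v.1
      · obtain ⟨i, hi⟩ := h
        exact ⟨i, fun j hj => (htwo hj.symm hi).le⟩
      · push Not at h
        exact ⟨⟨0, hk⟩, fun j _ => (h j).le⟩
    have : k * ∑ v ∈ Y, s v.1 ≤ 2 * ∑ v : V, s v.1 := by
      rw [hsum, ← sum_fiberwise Y Sigma.fst, mul_sum]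
      -- Only the exceptional layer `i` needs the trivial bound `k * n`.
      calc _ ≤ ∑ j : Fin k, (n + if j = i then k * n else 0) := by
            refine Finset.sum_le_sum fun j _ => ?_
            by_cases hj : j = i
            · rw [if_pos hj]
              exact (Nat.mul_le_mul_left k (hlayer j)).trans (Nat.le_add_left _ _)
            · rw [if_neg hj]
              exact hi j hj
        _ = 2 * (k * n) := by
            rw [Finset.sum_add_distrib, Finset.sum_ite_eq' univ i, if_pos (mem_univ _)]
            simp
            ring
    beta_reduce
    exact_mod_cast this
  -- The threshold uses `#A`, so every `S ⊆ B` meets the weaker lightness condition with `#S`.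
  · let B : Finset V := {v ∈ A | 32 * #A * s v.1 ^ 4 ≤ n}
    obtain ⟨T, hTB, hT, hBT⟩ := exists_isIndepSet_of_sparse G p q hGsample B fun S hS hne =>
      hsparse S hne fun v hv => by
        refine le_trans ?_ (mem_filter.1 (hS hv)).2
        gcongr
        exact hS.trans (filter_subset _ _)
    have hTA : T ⊆ A := hTB.trans (filter_subset _ _)
    rcases (A \ B).eq_empty_or_nonempty with hR | hR
    · refine ⟨T, hTA, hT, ?_⟩
      have := card_le_card (sdiff_eq_empty_iff_subset.1 hR)
      omega
    obtain ⟨v, hv, hmin⟩ := exists_min_image (A \ B) Sigma.fst hR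
    let C : Finset V := {u ∈ A | u.1 = v.1}
    let R : Finset V := {u ∈ A \ B | u.1 ≠ v.1}
    have hC : G.IsIndepSet (C : Set V) := fun x hx y hy _ h =>
      hGlayer h ((mem_filter.1 hx).2.trans (mem_filter.1 hy).2.symm)
    have hv4 : n < 32 * #A * s v.1 ^ 4 := by
      by_contra! h
      exact (mem_sdiff.1 hv).2 (mem_filter.2 ⟨(mem_sdiff.1 hv).1, h⟩)
    have hlayer (i : Fin k) : 2 * k * #{u ∈ R | u.1 = i} ≤ #A := by
      rcases ({u ∈ R | u.1 = i} : Finset V).eq_empty_or_nonempty with h | ⟨u, hu⟩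
      · simp [h]
      obtain ⟨huR, rfl⟩ := mem_filter.1 hu
      obtain ⟨huAB, hne⟩ := mem_filter.1 huR
      have hlt : v.1 < u.1 := lt_of_le_of_ne (hmin u huAB) hne.symm
      have h1 : s v.1 ^ 4 * (a * m u.1) < s v.1 ^ 4 * (32 * #A) := by
        calc s v.1 ^ 4 * (a * m u.1) = m u.1 * (a * s v.1 ^ 4) := by ring
          _ ≤ m u.1 * s u.1 := Nat.mul_le_mul_left _ (hsep hlt)
          _ < 32 * #A * s v.1 ^ 4 := by rwa [hms]
          _ = _ := by ring
      have h2 := Nat.lt_of_mul_lt_mul_left h1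
      have h3 : 64 * k * m u.1 ≤ a * m u.1 := Nat.mul_le_mul_right _ hak
      have h4 : 2 * k * #{x ∈ R | x.1 = u.1} ≤ 2 * k * m u.1 :=
        Nat.mul_le_mul_left _ (hfiber R u.1)
      have h5 : 64 * k * m u.1 = 32 * (2 * k * m u.1) := by ring
      omega
    have hRA : 2 * #R ≤ #A := by
      refine Nat.le_of_mul_le_mul_left ?_ hk
      calc k * (2 * #R) = ∑ i : Fin k, 2 * k * #{u ∈ R | u.1 = i} := by
            rw [← mul_sum, ← card_eq_sum_card_fiberwise fun _ _ => mem_coe.2 (mem_univ _)]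
            ring
        _ ≤ ∑ i : Fin k, #A := Finset.sum_le_sum fun i _ => hlayer i
        _ = k * #A := by simp
    have hAle : #A ≤ #B + #C + #R := by
      have : A ⊆ B ∪ C ∪ R := by
        intro u hu
        by_cases h1 : u ∈ B <;> by_cases h2 : u.1 = v.1 <;> simp [C, R, h1, h2, hu]
      refine (card_le_card this).trans ((card_union_le _ _).trans ?_)
      gcongr
      exact card_union_le _ _
    -- Here `#A ≤ 2 * (#B + #C) ≤ 8 * #T + 2 * #C`, so the larger of `T` and `C` suffices.
    rcases le_total #T #C with h | h
    · exact ⟨C, filter_subset _ _, hC, by omega⟩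
    · exact ⟨T, hTA, hT, by omega⟩

/-! ### Fixing the Hall ratio with a disjoint clique -/

/-- Graphs of Hall ratio exactly 18 may have arbitrarily large fractional chromatic number. -/
theorem exists_fractionalChromaticNumber_ge_hallRatio_eq (c : ℕ) :
    ∃ (n : ℕ) (G : SimpleGraph (Fin n)), 0 < n ∧
      (c : ℝ) ≤ G.fractionalChromaticNumber ∧ G.hallRatio = 18 := by
  classical
  -- The ratio `k / 2` must reach `c`; the `+ 1` keeps `k` positive when `c = 0`.
  obtain ⟨V, _, G, w, ⟨hw0, v₀, hv₀⟩, hwY, hA⟩ := exists_layered_graph (k := 2 * c + 1) (by omega)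
  let e := Fintype.equivFin (Fin 18 ⊕ V)
  let H : SimpleGraph (Fin (Fintype.card (Fin 18 ⊕ V))) :=
    ((⊤ : SimpleGraph (Fin 18)) ⊕g G).comap e.symm
  have hn : 0 < Fintype.card (Fin 18 ⊕ V) := Fintype.card_pos
  have : Nonempty (Fin (Fintype.card (Fin 18 ⊕ V))) := ⟨⟨0, hn⟩⟩
  refine ⟨_, H, hn, ?_, le_antisymm (H.hallRatio_le fun A hAne => ?_) ?_⟩
  -- Weight zero on the clique preserves the weight ratio of `G`.
  · let w' : Fin (Fintype.card (Fin 18 ⊕ V)) → ℝ := fun x => Sum.elim 0 w (e.symm x)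
    have hsum : ∑ x, w' x = ∑ v, w v := by
      rw [Equiv.sum_comp e.symm (Sum.elim 0 w), Fintype.sum_sum_type]
      simp
    have hpos : 0 < ∑ v, w v :=
      sum_pos' (fun v _ => hw0 v) ⟨v₀, mem_univ _, (hw0 v₀).lt_of_ne hv₀.symm⟩
    refine H.le_fractionalChromaticNumber (w := w') (b := 2 / (2 * c + 1) * ∑ v, w v)
      ⟨fun x => ?_, e (.inr v₀), by simpa [w'] using hv₀⟩ (by positivity) (fun Y hY => ?_) ?_
    · rcases h : e.symm x with i | v
      · simp [w', h]
      · simpa [w', h] using hw0 v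
    · let Z : Finset V := {v | e (.inr v) ∈ Y}
      have hZ : G.IsIndepSet (Z : Set V) := by
        intro u hu v hv huv hadj
        refine hY (mem_filter.1 hu).2 (mem_filter.1 hv).2 (by simpa using huv) ?_
        simpa [H] using hadj
      have hYZ : ∑ y ∈ Y, w' y = ∑ v ∈ Z, w v := by
        rw [← Finset.sum_ite_mem_eq Y, ← Equiv.sum_comp e, Fintype.sum_sum_type]
        simp [w', Z, Finset.sum_filter]
      have := hwY Z hZ
      push_cast at this
      rw [hYZ, div_mul_eq_mul_div, le_div_iff₀ (by positivity)]
      linarith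
    · rw [hsum, ← mul_assoc, mul_div_assoc']
      refine mul_le_of_le_one_left hpos.le ?_
      rw [div_le_one (by positivity)]
      linarith
  · let K : Finset (Fin 18) := {i | e (.inl i) ∈ A}
    let B : Finset V := {v | e (.inr v) ∈ A}
    have hAKB : A = (K.disjSum B).map e.toEmbedding := by
      ext x
      obtain ⟨y, rfl⟩ := e.surjective x
      rcases y with i | v <;> simp [K, B]
    have hcard : #A = #K + #B := by rw [hAKB, card_map, card_disjSum]
    obtain ⟨T, hTB, hT, hBT⟩ : ∃ T ⊆ B, G.IsIndepSet (T : Set V) ∧ #B ≤ 10 * #T := by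
      rcases B.eq_empty_or_nonempty with h | h
      · exact ⟨∅, empty_subset _, by simp, by simp [h]⟩
      · exact hA B h
    obtain ⟨L, hLK, hL, hKL⟩ : ∃ L ⊆ K, #L ≤ 1 ∧ #K ≤ 18 * #L := by
      rcases K.eq_empty_or_nonempty with h | ⟨i, hi⟩
      · exact ⟨∅, empty_subset _, by simp, by simp [h]⟩
      · exact ⟨{i}, singleton_subset_iff.2 hi, by simp, by simpa using card_le_univ K⟩
    refine ⟨(L.disjSum T).map e.toEmbedding, ?_, ?_, ?_⟩
    · rw [hAKB]
      exact map_subset_map.2 (disjSum_mono hLK hTB)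
    · intro x hx y hy hxy hadj
      obtain ⟨x, rfl⟩ := e.surjective x
      obtain ⟨y, rfl⟩ := e.surjective y
      rcases x with i | u <;> rcases y with j | v <;> simp [H] at hx hy hxy hadj
      · exact hxy (card_le_one.1 hL i hx j hy)
      · exact hT hx hy hxy hadj
    · rw [card_map, card_disjSum, hcard]
      have : #K + #B ≤ 18 * (#L + #T) := by omega
      exact_mod_cast this
  · let K : Finset (Fin (Fintype.card (Fin 18 ⊕ V))) :=
      (univ : Finset (Fin 18)).map (Function.Embedding.inl.trans e.toEmbedding)
    have hK : H.IsClique (K : Set _) := by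
      intro x hx y hy hxy
      obtain ⟨i, -, rfl⟩ := mem_map.1 hx
      obtain ⟨j, -, rfl⟩ := mem_map.1 hy
      have : i ≠ j := fun h => hxy (h ▸ rfl)
      simpa [H] using this
    simpa [K] using hK.card_le_hallRatio (by simp [K])

end SimpleGraph

theorem corollary3 :
    (∀ c : ℕ, 0 < c → ∃ (n : ℕ) (G : SimpleGraph (Fin n)),
      (c : ℝ) ≤ G.fractionalChromaticNumber ∧ G.hallRatio ≤ 18) ∧
    ¬ ∃ f : ℝ → ℝ, ∀ (n : ℕ) (G : SimpleGraph (Fin n)), 0 < n →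
      G.fractionalChromaticNumber ≤ f G.hallRatio := by
  refine ⟨fun c _ => ?_, fun ⟨f, hf⟩ => ?_⟩
  · obtain ⟨n, G, -, hc, h⟩ := SimpleGraph.exists_fractionalChromaticNumber_ge_hallRatio_eq c
    exact ⟨n, G, hc, h.le⟩
  · obtain ⟨c, hfc⟩ := exists_nat_gt (f 18)
    obtain ⟨n, G, hn, hc, h⟩ := SimpleGraph.exists_fractionalChromaticNumber_ge_hallRatio_eq c
    have := hf n G hn
    rw [h] at this
    linarith
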